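/- Let $(\Theta,\mathcal T)$ and $(\Omega,\mathcal F)$ be measurable spaces and let $(\mathbb P_\theta)_{\theta\in\Theta}$ be a transition kernel of probability measures from $\Theta$ to $\Omega$, with expectation $\mathbb E_\theta$ and law $\mathcal L_\theta$. A random variable is a measurable function $X:\Theta\times\Omega\to\mathbb R$, also written $X(\theta,\cdot)$ when $\theta$ is fixed. Let $Y$ be a random variable with $\mathbb E_\theta Y^2<\infty$ for all $\theta\in\Theta$; put $\mu_\theta=\mathbb E_\theta Y$, $\sigma_\theta^2=\operatorname{Var}_\theta Y$, and $W=(Y-\mu_\theta)/\sigma_\theta$ if $\sigma_\theta>0$, $W=0$ otherwise. Assume the following. (Z1) $r:\Theta\to(0,\infty)$ is measurable, $\overline r>0$, and $\operatorname{Var}_\theta Y>0$ for all $\theta\in\Theta_0:=\{\theta\in\Theta: r_\theta>\overline r\}$. (Z2) $W^*$ is a random variable such that, for each $\theta\in\Theta_0$, $W^*$ has under $\mathbb P_\theta$ the $W$-zero-biased distribution: $\mathbb E_\theta\{Wf(W)\}=\operatorname{Var}_\theta(W)\,\mathbb E_\theta\{f'(W^*)\}$ for all locally absolutely continuous $f:\mathbb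 R\to\mathbb R$ for which both expectations exist. (Z3) Let $D=W^*-W$. For each $\theta\in\Theta_0$, $\mathcal F_\theta\subset\mathcal F$ is a sub-$\sigma$-algebra and $F_{\theta,1}\in\mathcal F$ is an event (not necessarily in $\mathcal F_\theta$); $\overline D$ is a random variable such that, for each $\theta\in\Theta_0$, $\overline D(\theta,\cdot)$ is $\mathcal F_\theta$-measurable, $\overline D\ge 0$ $\mathbb P_\theta$-almost surely, $|D|\le\overline D$ almost surely on $F_{\theta,1}$, and $$\sup_{\theta\in\Theta_0} r_\theta^2\,\mathbb E_\theta\{|D|(1-I_{F_{\theta,1}})\}<\infty,\qquad \sup_{\theta\in\Theta_0} r_\theta\,\mathbb E_\theta\{|DW|+\overline D\}<\infty.$$ (Z4) $V$ is a random variable and $\Psi:\Theta\times\Omega\to\Theta$ is measurable, with $\Psi(\theta,\cdot)$ $\mathcal F_\theta$-measurable for each $\theta\in\Theta_0$; for each $\theta\in\Theta_0$, $F_{\theta,2}\in\mathcal F_\theta$ is an event such that $\mathcal L_\theta(V\mid\mathcal F_\theta)=\mathcal L_{\Psi}(Y)$ on $F_{\theta,2}$, that is, $\mathbb P_\theta[V\in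 A\mid\mathcal F_\theta](\omega)=\mathbb P_{\Psi(\theta,\omega)}[Y\in A]$ for every Borel set $A$ and $\mathbb P_\theta$-almost every $\omega\in F_{\theta,2}$; and $\sup_{\theta\in\Theta_0} r_\theta^2\,\mathbb E_\theta\{|D|(1-I_{F_{\theta,2}})\}<\infty$. (Z5) $\overline B$ is a random variable such that, for each $\theta\in\Theta_0$, $\overline B(\theta,\cdot)$ is $\mathcal F_\theta$-measurable, $\overline B\ge 0$ $\mathbb P_\theta$-almost surely, $\sigma_\theta^{-1}|Y-V|\le\overline B$ almost surely on $F_{\theta,1}$, and $$\sup_{\theta\in\Theta_0} r_\theta^2\,\mathbb E_\theta\{\overline D(\overline B+\overline D)I_{F_{\theta,2}}\}<\infty.$$ (G7) With essential suprema taken with respect to $\mathbb P_\theta$, $$\sup_{\theta\in\Theta_0}\ \operatorname*{ess\,sup}_{\omega\in F_{\theta,2}\cap\{\Psi\in\Theta_0\}}\frac{\sigma_\theta^2}{\sigma_{\Psi(\theta,\omega)}^2}<\infty,\quad \sup_{\theta\in\Theta_0}\ \operatorname*{ess\,sup}_{\omega\in F_{\theta,2}}\frac{r_\theta}{r_{\Psi(\theta,\omega)}}<\infty,\quad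 \sup_{\theta\in\Theta_0}\ \operatorname*{ess\,sup}_{\omega\in F_{\theta,2}\cap\{\Psi\in\Theta_0\}}\frac{r_{\Psi(\theta,\omega)}}{r_\theta}<\infty.$$ Then there exists a constant $C$, independent of $\theta$, such that, with $Z$ a standard normal random variable, $$\sup_{z\in\mathbb R}\bigl|\mathbb P_\theta[W\le z]-\mathbb P[Z\le z]\bigr|\le\frac{C}{r_\theta}\qquad\text{for all }\theta\in\Theta.$$ -/

import Mathlib

open MeasureTheory ProbabilityTheory

open scoped ENNReal

noncomputable section

/-- The mean `μ_θ = E_θ Y` of the random variable `Y` under the kernel `P`. -/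
def meanAt {Θ Ω : Type*} [MeasurableSpace Θ] [MeasurableSpace Ω]
    (P : Kernel Θ Ω) (Y : Θ → Ω → ℝ) (θ : Θ) : ℝ :=
  ∫ ω, Y θ ω ∂(P θ)

/-- The variance `σ_θ² = Var_θ Y`. -/
def varAt {Θ Ω : Type*} [MeasurableSpace Θ] [MeasurableSpace Ω]
    (P : Kernel Θ Ω) (Y : Θ → Ω → ℝ) (θ : Θ) : ℝ :=
  variance (Y θ) (P θ)

/-- The standard deviation `σ_θ`. -/
def sdAt {Θ Ω : Type*} [MeasurableSpace Θ] [MeasurableSpace Ω]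
    (P : Kernel Θ Ω) (Y : Θ → Ω → ℝ) (θ : Θ) : ℝ :=
  Real.sqrt (varAt P Y θ)

/-- The standardized variable: `W = (Y - μ_θ) / σ_θ` if `σ_θ > 0`, and `W = 0` otherwise. -/
def standardized {Θ Ω : Type*} [MeasurableSpace Θ] [MeasurableSpace Ω]
    (P : Kernel Θ Ω) (Y : Θ → Ω → ℝ) (θ : Θ) (ω : Ω) : ℝ :=
  if 0 < sdAt P Y θ then (Y θ ω - meanAt P Y θ) / sdAt P Y θ else 0

/-- The set of parameters on which the rate function exceeds the threshold. -/
def goodSet {Θ : Type*} (r : Θ → ℝ) (rbar : ℝ) : Set Θ :=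
  {θ | rbar < r θ}

/-- `Wstar` has the `W`-zero-biased distribution under `μ` (for `W` of mean zero and finite
positive variance): `E[W f(W)] = Var(W) E[f'(Wstar)]` for all locally absolutely continuous
functions `f` for which both expectations exist. -/
def IsZeroBias {Ω : Type*} [MeasurableSpace Ω] (μ : Measure Ω) (W Wstar : Ω → ℝ) : Prop :=
  ∀ f : ℝ → ℝ, (∀ a b : ℝ, AbsolutelyContinuousOnInterval f a b) →
    Integrable (fun ω => W ω * f (W ω)) μ →
    Integrable (fun ω => deriv f (Wstar ω)) μ →
    ∫ ω, W ω * f (W ω) ∂μ = variance W μ * ∫ ω, deriv f (Wstar ω) ∂μ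

/-- The Kolmogorov distance between the law of `X` under `μ` and the standard normal law. -/
def kolmogorovToNormal {Ω : Type*} [MeasurableSpace Ω] (μ : Measure Ω) (X : Ω → ℝ) : ℝ :=
  ⨆ z : ℝ, |μ.real {ω | X ω ≤ z} - (gaussianReal 0 1).real (Set.Iic z)|

end

/-!
Stein's equation and the zero-bias identity bound `|E h(W) - E h(Z)|`, for the ramp `h` falling
from `1` to `0` on `[z, z + l]`, by the moments of `D = W* - W` plus `E |h(W*) - h(W)|`. The last
term is of order `l⁻¹` times the mean of `|D|` over the event that `W`, hence the rescaled `V`, lies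
near `[z, z + l]`. Given `ℱ_θ`, the variable `V` is distributed as `Y` at the parameter `Ψ`, so the
probability of that event is at most twice the Kolmogorov distance at `Ψ` plus a term linear in the
length of the interval. Taking `l = K / r_θ` with `K` large makes the resulting recursion for the
distances contractive.
-/

local notation "φ" => gaussianPDFReal 0 1

section GaussianDensity

lemma hasDerivAt_gaussianPDFReal (m : ℝ) (v : NNReal) (x : ℝ) :
    HasDerivAt (gaussianPDFReal m v) (-((x - m) / v * gaussianPDFReal m v x)) x := by
  rw [gaussianPDFReal_def]
  have h : HasDerivAt (fun y : ℝ => -(y - m) ^ 2 / (2 * (v : ℝ))) (-((x - m) / v)) x := by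
    refine ((((hasDerivAt_id x).sub_const m).pow 2).neg.div_const (2 * (v : ℝ))).congr_deriv ?_
    simp only [id, Nat.cast_ofNat, Nat.add_one_sub_one, pow_one, mul_one]
    rw [neg_div, mul_div_mul_left _ _ two_ne_zero]
  exact (h.exp.const_mul _).congr_deriv (by ring)

lemma continuous_gaussianPDFReal (m : ℝ) (v : NNReal) : Continuous (gaussianPDFReal m v) :=
  continuous_iff_continuousAt.2 fun x => (hasDerivAt_gaussianPDFReal m v x).continuousAt

lemma hasDerivAt_stdGaussianPDF (x : ℝ) : HasDerivAt φ (-(x * φ x)) x :=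
  (hasDerivAt_gaussianPDFReal 0 1 x).congr_deriv (by simp)

lemma gaussianPDFReal_zero_neg (v : NNReal) (x : ℝ) :
    gaussianPDFReal 0 v (-x) = gaussianPDFReal 0 v x := by
  simp [gaussianPDFReal_def]

lemma stdGaussianPDF_eq (x : ℝ) : φ x = (√(2 * Real.pi))⁻¹ * Real.exp (-(x ^ 2 / 2)) := by
  simp [gaussianPDFReal_def, neg_div]

lemma stdGaussianPDF_le_one (x : ℝ) : φ x ≤ 1 := by
  rw [stdGaussianPDF_eq]
  have hsqrt : 1 ≤ √(2 * Real.pi) := Real.one_le_sqrt.2 (by linarith [Real.pi_gt_three])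
  exact mul_le_one₀ (inv_le_one_of_one_le₀ hsqrt) (Real.exp_pos _).le
    (Real.exp_le_one_iff.2 (neg_nonpos.2 (by positivity)))

lemma one_le_six_mul_stdGaussianPDF {w : ℝ} (hw : |w| ≤ 1) : 1 ≤ 6 * φ w := by
  have hsqrt : √(2 * Real.pi) ≤ 3 :=
    Real.sqrt_le_iff.2 ⟨by norm_num, by linarith [Real.pi_lt_four]⟩
  have hexp : 1 / 2 ≤ Real.exp (-(w ^ 2 / 2)) := by
    linarith [Real.add_one_le_exp (-(w ^ 2 / 2)), (sq_le_one_iff_abs_le_one w).2 hw]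
  rw [stdGaussianPDF_eq, ← mul_assoc, mul_comm 6, mul_assoc, ← div_eq_inv_mul,
    one_le_div (Real.sqrt_pos.2 (by positivity))]
  linarith

lemma tendsto_stdGaussianPDF_atTop : Filter.Tendsto φ Filter.atTop (nhds 0) := by
  have hsq : Filter.Tendsto (fun x : ℝ => x ^ 2 / 2) Filter.atTop Filter.atTop :=
    (Filter.tendsto_pow_atTop two_ne_zero).atTop_div_const two_pos
  simpa only [funext stdGaussianPDF_eq, mul_zero, Function.comp_def] using
    (Real.tendsto_exp_neg_atTop_nhds_zero.comp hsq).const_mul (√(2 * Real.pi))⁻¹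

lemma gaussianReal_real_eq_setIntegral (m : ℝ) {v : NNReal} (hv : v ≠ 0) (s : Set ℝ) :
    (gaussianReal m v).real s = ∫ x in s, gaussianPDFReal m v x := by
  rw [measureReal_def, gaussianReal_apply_eq_integral m hv, ENNReal.toReal_ofReal]
  exact integral_nonneg fun x => gaussianPDFReal_nonneg m v x

lemma gaussianReal_real_Iic_sub_le {a b : ℝ} (hab : a ≤ b) :
    (gaussianReal 0 1).real (Set.Iic b) - (gaussianReal 0 1).real (Set.Iic a) ≤ b - a := by
  have hφ := integrable_gaussianPDFReal 0 1
  simp only [gaussianReal_real_eq_setIntegral 0 one_ne_zero]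
  rw [intervalIntegral.integral_Iic_sub_Iic hφ.integrableOn hφ.integrableOn]
  simpa using intervalIntegral.integral_mono_on hab hφ.intervalIntegrable
    (intervalIntegrable_const (c := (1 : ℝ))) fun x _ => stdGaussianPDF_le_one x

/-- Mills' inequality, from `w φ x ≤ x φ x = -φ' x` on `(w, ∞)`. -/
lemma mul_setIntegral_Ioi_stdGaussianPDF_le {w : ℝ} (hw : 0 ≤ w) :
    w * ∫ x in Set.Ioi w, φ x ≤ φ w := by
  have hneg : ∀ x ∈ Set.Ioi w, -(x * φ x) ≤ 0 := fun x hx =>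
    neg_nonpos.2 (mul_nonneg (hw.trans (le_of_lt hx)) (gaussianPDFReal_nonneg 0 1 x))
  have hint : IntegrableOn (fun x => x * φ x) (Set.Ioi w) := by
    simpa only [Pi.neg_def, neg_neg] using (integrableOn_Ioi_deriv_of_nonpos'
      (fun x _ => hasDerivAt_stdGaussianPDF x) hneg tendsto_stdGaussianPDF_atTop).neg
  have hval : ∫ x in Set.Ioi w, x * φ x = φ w := by
    have h := integral_Ioi_of_hasDerivAt_of_nonpos' (fun x _ => hasDerivAt_stdGaussianPDF x) hneg
      tendsto_stdGaussianPDF_atTop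
    rwa [integral_neg, zero_sub, neg_inj] at h
  rw [← integral_const_mul, ← hval]
  exact setIntegral_mono_on ((integrable_gaussianPDFReal 0 1).const_mul w).integrableOn hint
    measurableSet_Ioi fun x hx =>
      mul_le_mul_of_nonneg_right (le_of_lt hx) (gaussianPDFReal_nonneg 0 1 x)

lemma neg_mul_setIntegral_Iic_stdGaussianPDF_le {w : ℝ} (hw : w ≤ 0) :
    -w * ∫ x in Set.Iic w, φ x ≤ φ w := by
  have hsymm : ∫ x in Set.Iic w, φ x = ∫ x in Set.Ioi (-w), φ x := by
    simp_rw [← integral_comp_neg_Iic, gaussianPDFReal_zero_neg]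
  rw [hsymm, ← gaussianPDFReal_zero_neg 1 w]
  exact mul_setIntegral_Ioi_stdGaussianPDF_le (neg_nonneg.2 hw)

end GaussianDensity

section SteinEquation

lemma hasDerivAt_setIntegral_Iic {E : Type*} [NormedAddCommGroup E] [NormedSpace ℝ E]
    [CompleteSpace E] {g : ℝ → E} {w : ℝ} (hg : Integrable g) (hgw : ContinuousAt g w) :
    HasDerivAt (fun u => ∫ x in Set.Iic u, g x) (g w) w := by
  have hsplit : (fun u => ∫ x in Set.Iic u, g x) =
      fun u => (∫ x in Set.Iic w, g x) + ∫ x in w..u, g x := by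
    ext u
    rw [← intervalIntegral.integral_Iic_sub_Iic hg.integrableOn hg.integrableOn, add_sub_cancel]
  rw [hsplit]
  exact (intervalIntegral.integral_hasDerivAt_right hg.intervalIntegrable
    hg.aestronglyMeasurable.stronglyMeasurableAtFilter hgw).const_add _

/-- The right-hand side `h - E h(Z)` of the Stein equation `f' w - w f w = h w - E h(Z)` for a
standard normal `Z`. -/
noncomputable def steinRHS (h : ℝ → ℝ) (x : ℝ) : ℝ := h x - ∫ y, h y ∂(gaussianReal 0 1)

/-- The bounded solution of the Stein equation with right-hand side `steinRHS h`. -/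
noncomputable def steinSolution (h : ℝ → ℝ) (w : ℝ) : ℝ :=
  (∫ x in Set.Iic w, steinRHS h x * φ x) / φ w

variable {h : ℝ → ℝ}

lemma abs_steinRHS_le_one (hm : Measurable h) (h01 : ∀ x, h x ∈ Set.Icc 0 1) (x : ℝ) :
    |steinRHS h x| ≤ 1 := by
  have hmean : ∫ y, h y ∂(gaussianReal 0 1) ∈ Set.Icc 0 1 :=
    (convex_Icc 0 1).integral_mem isClosed_Icc (.of_forall h01)
      (.of_mem_Icc 0 1 hm.aemeasurable (.of_forall h01))
  rw [steinRHS, abs_le]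
  constructor <;> linarith [(h01 x).1, (h01 x).2, hmean.1, hmean.2]

lemma abs_steinRHS_mul_le (hm : Measurable h) (h01 : ∀ x, h x ∈ Set.Icc 0 1) (x : ℝ) :
    |steinRHS h x * φ x| ≤ φ x := by
  rw [abs_mul, abs_of_nonneg (gaussianPDFReal_nonneg 0 1 x)]
  exact mul_le_of_le_one_left (gaussianPDFReal_nonneg 0 1 x) (abs_steinRHS_le_one hm h01 x)

lemma measurable_steinRHS (hm : Measurable h) : Measurable (steinRHS h) := hm.sub_const _

lemma integrable_steinRHS_mul (hm : Measurable h) (h01 : ∀ x, h x ∈ Set.Icc 0 1) :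
    Integrable (fun x => steinRHS h x * φ x) :=
  (integrable_gaussianPDFReal 0 1).mono'
    ((measurable_steinRHS hm).mul (measurable_gaussianPDFReal 0 1)).aestronglyMeasurable
    (.of_forall (abs_steinRHS_mul_le hm h01))

lemma integral_steinRHS_mul (hm : Measurable h) (h01 : ∀ x, h x ∈ Set.Icc 0 1) :
    ∫ x, steinRHS h x * φ x = 0 := by
  have hmean : ∫ x, steinRHS h x ∂(gaussianReal 0 1) = 0 := by
    simp only [steinRHS]
    rw [integral_sub (.of_mem_Icc 0 1 hm.aemeasurable (.of_forall h01)) (integrable_const _)]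
    simp
  simpa only [integral_gaussianReal_eq_integral_smul one_ne_zero, smul_eq_mul, mul_comm]
    using hmean

lemma abs_setIntegral_steinRHS_mul_le (hm : Measurable h) (h01 : ∀ x, h x ∈ Set.Icc 0 1)
    (s : Set ℝ) : |∫ x in s, steinRHS h x * φ x| ≤ ∫ x in s, φ x :=
  abs_integral_le_integral_abs.trans <|
    integral_mono (integrable_steinRHS_mul hm h01).integrableOn.abs
      (integrable_gaussianPDFReal 0 1).integrableOn (abs_steinRHS_mul_le hm h01)

lemma abs_mul_abs_setIntegral_Iic_steinRHS_mul_le (hm : Measurable h)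
    (h01 : ∀ x, h x ∈ Set.Icc 0 1) (w : ℝ) :
    |w| * |∫ x in Set.Iic w, steinRHS h x * φ x| ≤ φ w := by
  have hint := integrable_steinRHS_mul hm h01
  rcases le_total 0 w with hw | hw
  -- The total integral vanishes, so for `w ≥ 0` one integrates over the lighter upper tail.
  · have htail :
        ∫ x in Set.Iic w, steinRHS h x * φ x = -∫ x in Set.Ioi w, steinRHS h x * φ x := by
      rw [eq_neg_iff_add_eq_zero, intervalIntegral.integral_Iic_add_Ioi hint.integrableOn
        hint.integrableOn, integral_steinRHS_mul hm h01]
    rw [htail, abs_neg, abs_of_nonneg hw]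
    exact (mul_le_mul_of_nonneg_left (abs_setIntegral_steinRHS_mul_le hm h01 _) hw).trans
      (mul_setIntegral_Ioi_stdGaussianPDF_le hw)
  · rw [abs_of_nonpos hw]
    exact (mul_le_mul_of_nonneg_left (abs_setIntegral_steinRHS_mul_le hm h01 _)
      (neg_nonneg.2 hw)).trans (neg_mul_setIntegral_Iic_stdGaussianPDF_le hw)

lemma abs_mul_steinSolution_le (hm : Measurable h) (h01 : ∀ x, h x ∈ Set.Icc 0 1) (w : ℝ) :
    |w * steinSolution h w| ≤ 1 := by
  have hφ := gaussianPDFReal_pos 0 1 w one_ne_zero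
  rw [steinSolution, abs_mul, abs_div, abs_of_pos hφ, ← mul_div_assoc, div_le_one hφ]
  exact abs_mul_abs_setIntegral_Iic_steinRHS_mul_le hm h01 w

lemma abs_steinSolution_le (hm : Measurable h) (h01 : ∀ x, h x ∈ Set.Icc 0 1) (w : ℝ) :
    |steinSolution h w| ≤ 6 := by
  rcases le_total |w| 1 with hw | hw
  · have hφ := gaussianPDFReal_pos 0 1 w one_ne_zero
    rw [steinSolution, abs_div, abs_of_pos hφ, div_le_iff₀ hφ]
    refine (abs_setIntegral_steinRHS_mul_le hm h01 _).trans ?_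
    rw [← gaussianReal_real_eq_setIntegral 0 one_ne_zero]
    exact measureReal_le_one.trans (one_le_six_mul_stdGaussianPDF hw)
  · have h1 := abs_mul_steinSolution_le hm h01 w
    rw [abs_mul] at h1
    linarith [le_mul_of_one_le_left (abs_nonneg (steinSolution h w)) hw]

lemma hasDerivAt_steinSolution (hc : Continuous h) (h01 : ∀ x, h x ∈ Set.Icc 0 1) (w : ℝ) :
    HasDerivAt (steinSolution h) (w * steinSolution h w + steinRHS h w) w := by
  have hφ := (gaussianPDFReal_pos 0 1 w one_ne_zero).ne'
  have hnum := hasDerivAt_setIntegral_Iic (w := w) (integrable_steinRHS_mul hc.measurable h01)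
    ((hc.sub continuous_const).mul (continuous_gaussianPDFReal 0 1)).continuousAt
  refine (hnum.div (hasDerivAt_stdGaussianPDF w) hφ).congr_deriv ?_
  rw [steinSolution]
  field_simp
  ring

lemma abs_deriv_steinSolution_le (hc : Continuous h) (h01 : ∀ x, h x ∈ Set.Icc 0 1) (w : ℝ) :
    |deriv (steinSolution h) w| ≤ 2 := by
  rw [(hasDerivAt_steinSolution hc h01 w).deriv]
  linarith [abs_add_le (w * steinSolution h w) (steinRHS h w),
    abs_mul_steinSolution_le hc.measurable h01 w, abs_steinRHS_le_one hc.measurable h01 w]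

lemma lipschitzWith_steinSolution (hc : Continuous h) (h01 : ∀ x, h x ∈ Set.Icc 0 1) :
    LipschitzWith 2 (steinSolution h) :=
  lipschitzWith_of_nnnorm_deriv_le
    (fun w => (hasDerivAt_steinSolution hc h01 w).differentiableAt) fun w => by
      simpa only [← NNReal.coe_le_coe, coe_nnnorm, Real.norm_eq_abs, NNReal.coe_ofNat] using
        abs_deriv_steinSolution_le hc h01 w

end SteinEquation

section ZeroBias

lemma abs_deriv_steinSolution_sub_le {h : ℝ → ℝ} (hc : Continuous h)
    (h01 : ∀ x, h x ∈ Set.Icc 0 1) (x y : ℝ) :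
    |deriv (steinSolution h) x - deriv (steinSolution h) y| ≤
      6 * |y - x| + 2 * |(y - x) * x| + |h y - h x| := by
  set f := steinSolution h
  have hlip : |f y - f x| ≤ 2 * |y - x| := by
    simpa [Real.dist_eq] using (lipschitzWith_steinSolution hc h01).dist_le_mul y x
  have heq : deriv f x - deriv f y =
      -((y - x) * f y) + -(x * (f y - f x)) + -(h y - h x) := by
    rw [(hasDerivAt_steinSolution hc h01 x).deriv, (hasDerivAt_steinSolution hc h01 y).deriv,
      steinRHS, steinRHS]
    ring
  have h₁ : |(y - x) * f y| ≤ 6 * |y - x| := by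
    rw [abs_mul, mul_comm]
    exact mul_le_mul_of_nonneg_right (abs_steinSolution_le hc.measurable h01 y) (abs_nonneg _)
  have h₂ : |x * (f y - f x)| ≤ 2 * |(y - x) * x| := by
    rw [abs_mul, abs_mul, mul_comm |y - x|, mul_left_comm]
    exact mul_le_mul_of_nonneg_left hlip (abs_nonneg x)
  rw [heq]
  refine (abs_add_three _ _ _).trans ?_
  rw [abs_neg, abs_neg, abs_neg]
  gcongr

variable {Ω : Type*} [MeasurableSpace Ω] {μ : Measure Ω} [IsProbabilityMeasure μ]
  {W Wstar : Ω → ℝ} {h : ℝ → ℝ}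

lemma IsZeroBias.integral_sub_gaussian_eq (hzb : IsZeroBias μ W Wstar) (hW : Measurable W)
    (hWstar : Measurable Wstar) (hWi : Integrable W μ) (hvar : variance W μ = 1)
    (hc : Continuous h) (h01 : ∀ x, h x ∈ Set.Icc 0 1) :
    ∫ ω, h (W ω) ∂μ - ∫ x, h x ∂(gaussianReal 0 1) =
      ∫ ω, (deriv (steinSolution h) (W ω) - deriv (steinSolution h) (Wstar ω)) ∂μ := by
  set f := steinSolution h
  have hlip : LipschitzWith 2 f := lipschitzWith_steinSolution hc h01
  have hWf : Integrable (fun ω => W ω * f (W ω)) μ :=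
    hWi.mul_bdd (c := 6) (hlip.continuous.measurable.comp hW).aestronglyMeasurable
      (.of_forall fun ω => abs_steinSolution_le hc.measurable h01 _)
  have hf' : ∀ X : Ω → ℝ, Measurable X → Integrable (fun ω => deriv f (X ω)) μ := fun X hX =>
    .of_bound ((measurable_deriv f).comp hX).aestronglyMeasurable 2
      (.of_forall fun ω => abs_deriv_steinSolution_le hc h01 _)
  have hhW : Integrable (fun ω => h (W ω)) μ :=
    .of_mem_Icc 0 1 (hc.measurable.comp hW).aemeasurable (.of_forall fun ω => h01 _)
  have hbias : ∫ ω, W ω * f (W ω) ∂μ = ∫ ω, deriv f (Wstar ω) ∂μ := by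
    rw [hzb f (fun a b => hlip.lipschitzOnWith.absolutelyContinuousOnInterval) hWf
      (hf' _ hWstar), hvar, one_mul]
  rw [integral_sub (hf' _ hW) (hf' _ hWstar), ← hbias, ← integral_sub (hf' _ hW) hWf]
  have hstein : ∀ ω, deriv f (W ω) - W ω * f (W ω) = steinRHS h (W ω) := fun ω => by
    rw [(hasDerivAt_steinSolution hc h01 _).deriv, add_sub_cancel_left]
  simp only [hstein, steinRHS]
  rw [integral_sub hhW (integrable_const _), integral_const, probReal_univ, one_smul]

lemma IsZeroBias.ofReal_abs_integral_sub_gaussian_le (hzb : IsZeroBias μ W Wstar)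
    (hW : Measurable W) (hWstar : Measurable Wstar) (hWi : Integrable W μ)
    (hvar : variance W μ = 1) (hc : Continuous h) (h01 : ∀ x, h x ∈ Set.Icc 0 1) :
    ENNReal.ofReal |∫ ω, h (W ω) ∂μ - ∫ x, h x ∂(gaussianReal 0 1)| ≤
      6 * ∫⁻ ω, ENNReal.ofReal |Wstar ω - W ω| ∂μ +
        2 * ∫⁻ ω, ENNReal.ofReal |(Wstar ω - W ω) * W ω| ∂μ +
        ∫⁻ ω, ENNReal.ofReal |h (Wstar ω) - h (W ω)| ∂μ := by
  rw [hzb.integral_sub_gaussian_eq hW hWstar hWi hvar hc h01, ← Real.enorm_eq_ofReal_abs,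
    ← lintegral_const_mul _ (by fun_prop), ← lintegral_const_mul _ (by fun_prop),
    ← lintegral_add_left (by fun_prop), ← lintegral_add_left (by fun_prop)]
  refine (enorm_integral_le_lintegral_enorm _).trans (lintegral_mono fun ω => ?_)
  rw [Real.enorm_eq_ofReal_abs]
  refine (ENNReal.ofReal_le_ofReal
    (abs_deriv_steinSolution_sub_le hc h01 (W ω) (Wstar ω))).trans (le_of_eq ?_)
  rw [ENNReal.ofReal_add (by positivity) (by positivity),
    ENNReal.ofReal_add (by positivity) (by positivity), ENNReal.ofReal_mul (by positivity),
    ENNReal.ofReal_mul (by positivity), ENNReal.ofReal_ofNat, ENNReal.ofReal_ofNat]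

end ZeroBias

section Ramp

/-- The piecewise linear approximation of the indicator of `(-∞, z]`, equal to `1` up to `z`, to
`0` from `z + l` on, and of slope `-1 / l` in between; it is the test function of the smoothing
argument. -/
noncomputable def ramp (z l x : ℝ) : ℝ := max 0 (min 1 ((z + l - x) / l))

variable {z l x y : ℝ}

lemma continuous_ramp (z l : ℝ) : Continuous (ramp z l) := by
  unfold ramp
  fun_prop

lemma ramp_mem_Icc (z l x : ℝ) : ramp z l x ∈ Set.Icc 0 1 :=
  ⟨le_max_left _ _, max_le zero_le_one (min_le_left _ _)⟩

lemma ramp_of_le (hl : 0 < l) (hx : x ≤ z) : ramp z l x = 1 := by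
  have hslope : 1 ≤ (z + l - x) / l := (one_le_div hl).2 (by linarith)
  rw [ramp, min_eq_left hslope, max_eq_right zero_le_one]

lemma ramp_of_ge (hl : 0 < l) (hx : z + l ≤ x) : ramp z l x = 0 :=
  max_eq_left ((min_le_right _ _).trans
    (div_nonpos_of_nonpos_of_nonneg (sub_nonpos.2 hx) hl.le))

lemma abs_ramp_sub_le (hl : 0 < l) (x y : ℝ) : |ramp z l y - ramp z l x| ≤ |y - x| / l :=
  calc |ramp z l y - ramp z l x|
      ≤ |min 1 ((z + l - y) / l) - min 1 ((z + l - x) / l)| := by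
        simpa only [ramp, max_comm (0 : ℝ)] using abs_max_sub_max_le_abs _ _ _
    _ ≤ |(z + l - y) / l - (z + l - x) / l| := by
        refine (abs_min_sub_min_le_max _ _ _ _).trans_eq ?_
        rw [sub_self, abs_zero, max_eq_right (abs_nonneg _)]
    _ = |y - x| / l := by
        rw [← sub_div, abs_div, abs_of_pos hl, sub_sub_sub_cancel_left, abs_sub_comm]

lemma ramp_eq_of_notMem_Icc {d : ℝ} (hl : 0 < l) (hd : |y - x| ≤ d)
    (hx : x ∉ Set.Icc (z - d) (z + l + d)) : ramp z l y = ramp z l x := by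
  obtain ⟨hd₁, hd₂⟩ := abs_le.1 hd
  have hd₀ := (abs_nonneg _).trans hd
  rw [Set.mem_Icc, not_and_or, not_le, not_le] at hx
  rcases hx with hx | hx
  · rw [ramp_of_le hl (by linarith), ramp_of_le hl (by linarith)]
  · rw [ramp_of_ge hl (by linarith), ramp_of_ge hl (by linarith)]

end Ramp

section Kolmogorov

variable {Ω : Type*} [MeasurableSpace Ω] {μ : Measure Ω}

lemma kolmogorovToNormal_nonneg (μ : Measure Ω) (X : Ω → ℝ) : 0 ≤ kolmogorovToNormal μ X :=
  Real.iSup_nonneg fun _ => abs_nonneg _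

variable [IsProbabilityMeasure μ] {X : Ω → ℝ}

lemma abs_measureReal_le_sub_gaussianReal_le_one (X : Ω → ℝ) (z : ℝ) :
    |μ.real {ω | X ω ≤ z} - (gaussianReal 0 1).real (Set.Iic z)| ≤ 1 :=
  abs_sub_le_of_nonneg_of_le measureReal_nonneg measureReal_le_one measureReal_nonneg
    measureReal_le_one

lemma kolmogorovToNormal_le_one (X : Ω → ℝ) : kolmogorovToNormal μ X ≤ 1 :=
  ciSup_le (abs_measureReal_le_sub_gaussianReal_le_one X)

lemma abs_sub_le_kolmogorovToNormal (X : Ω → ℝ) (z : ℝ) :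
    |μ.real {ω | X ω ≤ z} - (gaussianReal 0 1).real (Set.Iic z)| ≤ kolmogorovToNormal μ X :=
  le_ciSup (f := fun z : ℝ => |μ.real {ω | X ω ≤ z} - (gaussianReal 0 1).real (Set.Iic z)|)
    ⟨1, Set.forall_mem_range.2 (abs_measureReal_le_sub_gaussianReal_le_one X)⟩ z

lemma integrable_ramp_comp (hX : Measurable X) (z l : ℝ) :
    Integrable (fun ω => ramp z l (X ω)) μ :=
  .of_mem_Icc 0 1 ((continuous_ramp z l).measurable.comp hX).aemeasurable
    (.of_forall fun _ => ramp_mem_Icc _ _ _)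

lemma measureReal_le_integral_ramp (hX : Measurable X) {l : ℝ} (hl : 0 < l) (z : ℝ) :
    μ.real {ω | X ω ≤ z} ≤ ∫ ω, ramp z l (X ω) ∂μ := by
  have hs : MeasurableSet {ω | X ω ≤ z} := measurableSet_le hX measurable_const
  rw [← integral_indicator_one hs]
  refine integral_mono ((integrable_const (1 : ℝ)).indicator hs) (integrable_ramp_comp hX z l)
    (Set.indicator_le' (fun ω hω => ?_) fun ω _ => (ramp_mem_Icc z l _).1)
  exact (ramp_of_le hl hω).ge

lemma integral_ramp_le_measureReal (hX : Measurable X) {l : ℝ} (hl : 0 < l) (z : ℝ) :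
    ∫ ω, ramp z l (X ω) ∂μ ≤ μ.real {ω | X ω ≤ z + l} := by
  have hs : MeasurableSet {ω | X ω ≤ z + l} := measurableSet_le hX measurable_const
  rw [← integral_indicator_one hs]
  refine integral_mono (integrable_ramp_comp hX z l) ((integrable_const (1 : ℝ)).indicator hs)
    (Set.le_indicator (fun ω _ => (ramp_mem_Icc z l _).2) fun ω hω => ?_)
  exact (ramp_of_ge hl (not_le.1 hω).le).le

lemma kolmogorovToNormal_le_of_ramp (hX : Measurable X) {l ε : ℝ} (hl : 0 < l)
    (h : ∀ z, |∫ ω, ramp z l (X ω) ∂μ - ∫ x, ramp z l x ∂(gaussianReal 0 1)| ≤ ε) :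
    kolmogorovToNormal μ X ≤ l + ε := by
  have hγ_le : ∀ z, (gaussianReal 0 1).real (Set.Iic z) ≤ ∫ x, ramp z l x ∂(gaussianReal 0 1) :=
    measureReal_le_integral_ramp measurable_id hl
  have hγ_ge : ∀ z,
      ∫ x, ramp z l x ∂(gaussianReal 0 1) ≤ (gaussianReal 0 1).real (Set.Iic (z + l)) :=
    integral_ramp_le_measureReal measurable_id hl
  refine ciSup_le fun z => abs_sub_le_iff.2 ⟨?_, ?_⟩
  · have hcdf := gaussianReal_real_Iic_sub_le (le_add_of_nonneg_right hl.le : z ≤ z + l)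
    linarith [(abs_le.1 (h z)).2, measureReal_le_integral_ramp (μ := μ) hX hl z, hγ_ge z]
  · have hcdf := gaussianReal_real_Iic_sub_le (sub_le_self z hl.le)
    have hX_ge := integral_ramp_le_measureReal (μ := μ) hX hl (z - l)
    rw [sub_add_cancel] at hX_ge
    linarith [(abs_le.1 (h (z - l))).1, hγ_le (z - l)]

lemma measureReal_preimage_Icc_le_kolmogorovToNormal (hX : Measurable X) {a b : ℝ}
    (hab : a ≤ b) : μ.real (X ⁻¹' Set.Icc a b) ≤ 2 * kolmogorovToNormal μ X + (b - a) := by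
  refine le_of_forall_pos_le_add fun ε hε => ?_
  have hs : MeasurableSet {ω | X ω ≤ a - ε} := measurableSet_le hX measurable_const
  have hsub : {ω | X ω ≤ a - ε} ⊆ {ω | X ω ≤ b} := fun ω (hω : X ω ≤ a - ε) =>
    hω.trans (by linarith)
  have hcover : X ⁻¹' Set.Icc a b ⊆ {ω | X ω ≤ b} \ {ω | X ω ≤ a - ε} := fun ω hω =>
    ⟨hω.2, fun hω' : X ω ≤ a - ε => by linarith [hω.1]⟩
  have hdiff : μ.real (X ⁻¹' Set.Icc a b) ≤ μ.real {ω | X ω ≤ b} - μ.real {ω | X ω ≤ a - ε} :=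
    (measureReal_mono hcover).trans_eq (measureReal_sdiff hsub hs)
  have hcdf := gaussianReal_real_Iic_sub_le (show a - ε ≤ b by linarith)
  linarith [(abs_le.1 (abs_sub_le_kolmogorovToNormal (μ := μ) X b)).2,
    (abs_le.1 (abs_sub_le_kolmogorovToNormal (μ := μ) X (a - ε))).1]

end Kolmogorov

section ConditionalConcentration

lemma measure_Icc_le_of_forall_rat {ν : Measure ℝ} {g : ℝ → ℝ≥0∞} (hg : Continuous g)
    (h : ∀ x y : ℚ, x ≤ y → ν (Set.Icc x y) ≤ g (y - x)) {a b : ℝ} (hab : a ≤ b) :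
    ν (Set.Icc a b) ≤ g (b - a) := by
  obtain ⟨x, -, hx, hxa⟩ := Real.exists_seq_rat_strictMono_tendsto a
  obtain ⟨y, -, hy, hyb⟩ := Real.exists_seq_rat_strictAnti_tendsto b
  refine ge_of_tendsto' ((hg.tendsto _).comp (hyb.sub hxa)) fun n => ?_
  have hxy : x n ≤ y n := by exact_mod_cast (hx n).le.trans (hab.trans (hy n).le)
  exact (measure_mono (Set.Icc_subset_Icc (hx n).le (hy n).le)).trans (h _ _ hxy)

lemma measurable_indicator_Icc {α : Type*} [MeasurableSpace α] {a b u : α → ℝ} (ha : Measurable a)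
    (hb : Measurable b) (hu : Measurable u) :
    Measurable fun ω => (Set.Icc (a ω) (b ω)).indicator (1 : ℝ → ℝ≥0∞) (u ω) :=
  measurable_one.indicator ((measurableSet_le ha hu).inter (measurableSet_le hu hb))

section CondDistrib

variable {α β Ω : Type*} [MeasurableSpace α] [MeasurableSpace β] {μ : Measure α}
  [IsFiniteMeasure μ] {X : α → β} {F : Set β}

lemma setLIntegral_eq_setLIntegral_condDistrib [MeasurableSpace Ω] [StandardBorelSpace Ω]
    [Nonempty Ω] {Y : α → Ω} (hX : Measurable X) (hY : Measurable Y) (hF : MeasurableSet F)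
    {f : β × Ω → ℝ≥0∞} (hf : Measurable f) :
    ∫⁻ ω in X ⁻¹' F, f (X ω, Y ω) ∂μ =
      ∫⁻ ω in X ⁻¹' F, ∫⁻ y, f (X ω, y) ∂(condDistrib Y X μ (X ω)) ∂μ := by
  have hpre : X ⁻¹' F = (fun ω => (X ω, Y ω)) ⁻¹' (F ×ˢ Set.univ) := by
    ext ω
    simp only [Set.mem_preimage, Set.mem_prod, Set.mem_univ, and_true]
  calc ∫⁻ ω in X ⁻¹' F, f (X ω, Y ω) ∂μ
      = ∫⁻ p in F ×ˢ Set.univ, f p ∂(μ.map X ⊗ₘ condDistrib Y X μ) := by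
        rw [hpre, ← setLIntegral_map (hF.prod .univ) hf (hX.prodMk hY),
          compProd_map_condDistrib hY.aemeasurable]
    _ = ∫⁻ ω in X ⁻¹' F, ∫⁻ y, f (X ω, y) ∂(condDistrib Y X μ (X ω)) ∂μ := by
        simp only [Measure.setLIntegral_compProd hf hF .univ, Measure.restrict_univ]
        exact setLIntegral_map hF hf.lintegral_kernel_prod_right' hX

variable {V : α → ℝ} {a b : β → ℝ} {g : ℝ → ℝ≥0∞}

lemma ae_condDistrib_Icc_le (hg : Continuous g) (h : ∀ x y : ℝ, x ≤ y →
      ∀ᵐ ω ∂μ, X ω ∈ F → condDistrib V X μ (X ω) (Set.Icc x y) ≤ g (y - x)) :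
    ∀ᵐ ω ∂μ, X ω ∈ F →
      condDistrib V X μ (X ω) (Set.Icc (a (X ω)) (b (X ω))) ≤ g (b (X ω) - a (X ω)) := by
  have hrat : ∀ᵐ ω ∂μ, ∀ x y : ℚ, x ≤ y → X ω ∈ F →
      condDistrib V X μ (X ω) (Set.Icc x y) ≤ g (y - x) := by
    simp only [ae_all_iff]
    exact fun x y hxy => h x y (Rat.cast_le.2 hxy)
  filter_upwards [hrat] with ω hω hωF
  rcases le_or_gt (a (X ω)) (b (X ω)) with hab | hab
  · exact measure_Icc_le_of_forall_rat hg (fun x y hxy => hω x y hxy hωF) hab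
  · rw [Set.Icc_eq_empty_of_lt hab, measure_empty]
    exact zero_le

lemma setLIntegral_mul_indicator_Icc_le_of_condDistrib {d : β → ℝ≥0∞} (hX : Measurable X)
    (hV : Measurable V) (hF : MeasurableSet F) (hd : Measurable d) (ha : Measurable a)
    (hb : Measurable b) (hg : Continuous g) (h : ∀ x y : ℝ, x ≤ y →
      ∀ᵐ ω ∂μ, X ω ∈ F → condDistrib V X μ (X ω) (Set.Icc x y) ≤ g (y - x)) :
    ∫⁻ ω in X ⁻¹' F, d (X ω) * (Set.Icc (a (X ω)) (b (X ω))).indicator 1 (V ω) ∂μ ≤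
      ∫⁻ ω in X ⁻¹' F, d (X ω) * g (b (X ω) - a (X ω)) ∂μ := by
  have hf : Measurable fun p : β × ℝ => d p.1 * (Set.Icc (a p.1) (b p.1)).indicator 1 p.2 :=
    (hd.comp measurable_fst).mul (measurable_indicator_Icc (ha.comp measurable_fst)
      (hb.comp measurable_fst) measurable_snd)
  calc ∫⁻ ω in X ⁻¹' F, d (X ω) * (Set.Icc (a (X ω)) (b (X ω))).indicator 1 (V ω) ∂μ
      = ∫⁻ ω in X ⁻¹' F, ∫⁻ y, d (X ω) * (Set.Icc (a (X ω)) (b (X ω))).indicator 1 y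
          ∂(condDistrib V X μ (X ω)) ∂μ :=
        setLIntegral_eq_setLIntegral_condDistrib hX hV hF hf
    _ = ∫⁻ ω in X ⁻¹' F, d (X ω) *
          condDistrib V X μ (X ω) (Set.Icc (a (X ω)) (b (X ω))) ∂μ := by
        refine lintegral_congr fun ω => ?_
        rw [lintegral_const_mul _ (measurable_one.indicator measurableSet_Icc),
          lintegral_indicator_one measurableSet_Icc]
    _ ≤ ∫⁻ ω in X ⁻¹' F, d (X ω) * g (b (X ω) - a (X ω)) ∂μ :=
        setLIntegral_mono_ae' (hX hF) ((ae_condDistrib_Icc_le hg h).mono fun ω hω hωF =>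
          mul_le_mul_right (hω hωF) _)

end CondDistrib

lemma setLIntegral_mul_indicator_Icc_le {Ω : Type*} {m mΩ : MeasurableSpace Ω} (hm : m ≤ mΩ)
    {μ : Measure Ω} [IsFiniteMeasure μ] {V a b : Ω → ℝ} {F : Set Ω} {d : Ω → ℝ≥0∞} {g : ℝ → ℝ}
    (hV : Measurable V) (hF : MeasurableSet[m] F) (hd : Measurable[m] d) (ha : Measurable[m] a)
    (hb : Measurable[m] b) (hg : Continuous g)
    (h : ∀ x y : ℝ, x ≤ y → ∀ᵐ ω ∂μ, ω ∈ F → (μ⟦V ⁻¹' Set.Icc x y | m⟧) ω ≤ g (y - x)) :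
    ∫⁻ ω in F, d ω * (Set.Icc (a ω) (b ω)).indicator 1 (V ω) ∂μ ≤
      ∫⁻ ω in F, d ω * ENNReal.ofReal (g (b ω - a ω)) ∂μ := by
  have hid : Measurable[mΩ, m] id := measurable_id'' hm
  refine @setLIntegral_mul_indicator_Icc_le_of_condDistrib Ω Ω mΩ m μ _ id F V a b
    (fun x => ENNReal.ofReal (g x)) d hid hV hF hd ha hb (ENNReal.continuous_ofReal.comp hg)
    fun x y hxy => ?_
  have hcond := condDistrib_ae_eq_condExp (μ := μ) (mβ := m) hid hV
    (measurableSet_Icc (a := x) (b := y))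
  rw [MeasurableSpace.comap_id] at hcond
  filter_upwards [hcond, h x y hxy] with ω hω hle hωF
  rw [← ofReal_measureReal]
  exact ENNReal.ofReal_le_ofReal (hω.trans_le (hle hωF))

end ConditionalConcentration

section Embedding

/-- A zero-bias coupling `(W, Wstar)` together with an embedded variable `U` whose law is only
controlled conditionally on `m`. The bounds `Dbar` and `Bbar` on `|Wstar - W|` and `|W - U|` are
`m`-measurable but need only hold on `F₁`, which need not belong to `m`; conditional information
about `U` is used on `F₂ ∈ m`. In the paper, `U = (V - μ_θ) / σ_θ`. -/
structure IsZeroBiasEmbedding {Ω : Type*} (m mΩ : MeasurableSpace Ω) (μ : Measure[mΩ] Ω)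
    (W Wstar Dbar Bbar U : Ω → ℝ) (F₁ F₂ : Set Ω) : Prop where
  le : m ≤ mΩ
  measurable_W : Measurable W
  measurable_Wstar : Measurable Wstar
  measurable_U : Measurable U
  integrable_W : Integrable W μ
  variance_W : variance W μ = 1
  isZeroBias : IsZeroBias μ W Wstar
  measurable_Dbar : Measurable[m] Dbar
  Dbar_nonneg : ∀ᵐ ω ∂μ, 0 ≤ Dbar ω
  measurable_Bbar : Measurable[m] Bbar
  Bbar_nonneg : ∀ᵐ ω ∂μ, 0 ≤ Bbar ω
  measurableSet_F₂ : MeasurableSet[m] F₂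
  abs_Wstar_sub_W_le : ∀ᵐ ω ∂μ, ω ∈ F₁ → |Wstar ω - W ω| ≤ Dbar ω
  abs_W_sub_U_le : ∀ᵐ ω ∂μ, ω ∈ F₁ → |W ω - U ω| ≤ Bbar ω

lemma lintegral_le_setLIntegral_compl_add {α : Type*} [MeasurableSpace α] {μ : Measure α}
    (f : α → ℝ≥0∞) (s : Set α) : ∫⁻ x, f x ∂μ ≤ ∫⁻ x in sᶜ, f x ∂μ + ∫⁻ x in s, f x ∂μ := by
  simpa only [Set.compl_union_self, Measure.restrict_univ] using lintegral_union_le f sᶜ s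

lemma ofReal_abs_ramp_sub_le {z l : ℝ} (hl : 0 < l) (x y : ℝ) :
    ENNReal.ofReal |ramp z l y - ramp z l x| ≤ ENNReal.ofReal (1 / l) * ENNReal.ofReal |y - x| := by
  rw [← ENNReal.ofReal_mul (by positivity), one_div_mul_eq_div]
  exact ENNReal.ofReal_le_ofReal (abs_ramp_sub_le hl x y)

lemma ofReal_abs_ramp_sub_le_mul_indicator {z l x y u d b : ℝ} (hl : 0 < l) (hd : |y - x| ≤ d)
    (hb : |x - u| ≤ b) :
    ENNReal.ofReal |ramp z l y - ramp z l x| ≤ ENNReal.ofReal (1 / l) *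
      (ENNReal.ofReal d * (Set.Icc (z - d - b) (z + l + d + b)).indicator 1 u) := by
  by_cases hx : x ∈ Set.Icc (z - d) (z + l + d)
  · have hu : u ∈ Set.Icc (z - d - b) (z + l + d + b) := by
      obtain ⟨hb₁, hb₂⟩ := abs_le.1 hb
      exact ⟨by linarith [hx.1], by linarith [hx.2]⟩
    rw [Set.indicator_of_mem hu, Pi.one_apply, mul_one]
    exact (ofReal_abs_ramp_sub_le hl x y).trans (by gcongr)
  · rw [ramp_eq_of_notMem_Icc hl hd hx, sub_self, abs_zero, ENNReal.ofReal_zero]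
    exact zero_le

namespace IsZeroBiasEmbedding

variable {Ω : Type*} {m mΩ : MeasurableSpace Ω} {μ : Measure Ω}
  {W Wstar Dbar Bbar U : Ω → ℝ} {F₁ F₂ : Set Ω} {z l q s : ℝ}

lemma lintegral_abs_sub_le (h : IsZeroBiasEmbedding m mΩ μ W Wstar Dbar Bbar U F₁ F₂) :
    ∫⁻ ω, ENNReal.ofReal |Wstar ω - W ω| ∂μ ≤
      ∫⁻ ω in F₁ᶜ, ENNReal.ofReal |Wstar ω - W ω| ∂μ + ∫⁻ ω, ENNReal.ofReal (Dbar ω) ∂μ := by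
  have hDbar : Measurable Dbar := h.measurable_Dbar.mono h.le le_rfl
  refine (lintegral_le_setLIntegral_compl_add _ F₁).trans (add_le_add_right ?_ _)
  calc ∫⁻ ω in F₁, ENNReal.ofReal |Wstar ω - W ω| ∂μ
      ≤ ∫⁻ ω in F₁, ENNReal.ofReal (Dbar ω) ∂μ :=
        setLIntegral_mono_ae hDbar.ennreal_ofReal.aemeasurable
          (h.abs_Wstar_sub_W_le.mono fun ω hω hF => ENNReal.ofReal_le_ofReal (hω hF))
    _ ≤ ∫⁻ ω, ENNReal.ofReal (Dbar ω) ∂μ := setLIntegral_le_lintegral _ _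

lemma lintegral_abs_ramp_sub_le (h : IsZeroBiasEmbedding m mΩ μ W Wstar Dbar Bbar U F₁ F₂)
    (hl : 0 < l) :
    ∫⁻ ω, ENNReal.ofReal |ramp z l (Wstar ω) - ramp z l (W ω)| ∂μ ≤ ENNReal.ofReal (1 / l) *
      (∫⁻ ω in F₁ᶜ, ENNReal.ofReal |Wstar ω - W ω| ∂μ +
        ∫⁻ ω in F₂ᶜ, ENNReal.ofReal |Wstar ω - W ω| ∂μ +
        ∫⁻ ω in F₂, ENNReal.ofReal (Dbar ω) *
          (Set.Icc (z - Dbar ω - Bbar ω) (z + l + Dbar ω + Bbar ω)).indicator 1 (U ω) ∂μ) := by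
  have hDbar : Measurable Dbar := h.measurable_Dbar.mono h.le le_rfl
  have hBbar : Measurable Bbar := h.measurable_Bbar.mono h.le le_rfl
  have hind : Measurable fun ω => ENNReal.ofReal (Dbar ω) *
      (Set.Icc (z - Dbar ω - Bbar ω) (z + l + Dbar ω + Bbar ω)).indicator 1 (U ω) :=
    hDbar.ennreal_ofReal.mul
      (measurable_indicator_Icc (by fun_prop) (by fun_prop) h.measurable_U)
  have hbad : ∫⁻ ω in (F₁ ∩ F₂)ᶜ, ENNReal.ofReal |ramp z l (Wstar ω) - ramp z l (W ω)| ∂μ ≤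
      ENNReal.ofReal (1 / l) * (∫⁻ ω in F₁ᶜ, ENNReal.ofReal |Wstar ω - W ω| ∂μ +
        ∫⁻ ω in F₂ᶜ, ENNReal.ofReal |Wstar ω - W ω| ∂μ) := by
    refine (lintegral_mono fun ω => ofReal_abs_ramp_sub_le hl _ _).trans ?_
    rw [lintegral_const_mul' _ _ ENNReal.ofReal_ne_top, Set.compl_inter]
    exact mul_le_mul_right (lintegral_union_le _ _ _) _
  have hgood : ∫⁻ ω in F₁ ∩ F₂, ENNReal.ofReal |ramp z l (Wstar ω) - ramp z l (W ω)| ∂μ ≤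
      ENNReal.ofReal (1 / l) * ∫⁻ ω in F₂, ENNReal.ofReal (Dbar ω) *
        (Set.Icc (z - Dbar ω - Bbar ω) (z + l + Dbar ω + Bbar ω)).indicator 1 (U ω) ∂μ := by
    rw [← lintegral_const_mul _ hind]
    refine (setLIntegral_mono_ae (hind.const_mul _).aemeasurable ?_).trans
      (lintegral_mono_set Set.inter_subset_right)
    filter_upwards [h.abs_Wstar_sub_W_le, h.abs_W_sub_U_le] with ω hD hB hω
    exact ofReal_abs_ramp_sub_le_mul_indicator hl (hD hω.1) (hB hω.1)
  rw [mul_add]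
  exact (lintegral_le_setLIntegral_compl_add _ (F₁ ∩ F₂)).trans (add_le_add hbad hgood)

variable [IsProbabilityMeasure μ]

lemma setLIntegral_Dbar_mul_indicator_le
    (h : IsZeroBiasEmbedding m mΩ μ W Wstar Dbar Bbar U F₁ F₂) (hl : 0 ≤ l) (hq : 0 ≤ q)
    (hs : 0 ≤ s) (hconc : ∀ x y : ℝ, x ≤ y → ∀ᵐ ω ∂μ, ω ∈ F₂ →
      (μ⟦U ⁻¹' Set.Icc x y | m⟧) ω ≤ q + s * (y - x)) :
    ∫⁻ ω in F₂, ENNReal.ofReal (Dbar ω) *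
        (Set.Icc (z - Dbar ω - Bbar ω) (z + l + Dbar ω + Bbar ω)).indicator 1 (U ω) ∂μ ≤
      ENNReal.ofReal (q + s * l) * ∫⁻ ω, ENNReal.ofReal (Dbar ω) ∂μ +
        ENNReal.ofReal (2 * s) *
          ∫⁻ ω in F₂, ENNReal.ofReal (Dbar ω * (Bbar ω + Dbar ω)) ∂μ := by
  have hDbar : Measurable Dbar := h.measurable_Dbar.mono h.le le_rfl
  have hDbar' := h.measurable_Dbar
  have hBbar' := h.measurable_Bbar
  have hwidth : ∀ᵐ ω ∂μ, ENNReal.ofReal (Dbar ω) * ENNReal.ofReal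
        (q + s * ((z + l + Dbar ω + Bbar ω) - (z - Dbar ω - Bbar ω))) =
      ENNReal.ofReal (q + s * l) * ENNReal.ofReal (Dbar ω) +
        ENNReal.ofReal (2 * s) * ENNReal.ofReal (Dbar ω * (Bbar ω + Dbar ω)) := by
    filter_upwards [h.Dbar_nonneg, h.Bbar_nonneg] with ω hD hB
    rw [← ENNReal.ofReal_mul hD, ← ENNReal.ofReal_mul (by positivity),
      ← ENNReal.ofReal_mul (by positivity), ← ENNReal.ofReal_add (by positivity) (by positivity)]
    ring_nf
  calc _ ≤ ∫⁻ ω in F₂, ENNReal.ofReal (Dbar ω) * ENNReal.ofReal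
          (q + s * ((z + l + Dbar ω + Bbar ω) - (z - Dbar ω - Bbar ω))) ∂μ :=
        setLIntegral_mul_indicator_Icc_le h.le (g := fun x => q + s * x) h.measurable_U
          h.measurableSet_F₂ hDbar'.ennreal_ofReal (by fun_prop) (by fun_prop) (by fun_prop) hconc
    _ = ENNReal.ofReal (q + s * l) * ∫⁻ ω in F₂, ENNReal.ofReal (Dbar ω) ∂μ +
          ENNReal.ofReal (2 * s) *
            ∫⁻ ω in F₂, ENNReal.ofReal (Dbar ω * (Bbar ω + Dbar ω)) ∂μ := by
        rw [lintegral_congr_ae (ae_restrict_of_ae hwidth),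
          lintegral_add_left (by fun_prop), lintegral_const_mul' _ _ ENNReal.ofReal_ne_top,
          lintegral_const_mul' _ _ ENNReal.ofReal_ne_top]
    _ ≤ _ := by
        gcongr
        exact Measure.restrict_le_self

theorem kolmogorovToNormal_le (h : IsZeroBiasEmbedding m mΩ μ W Wstar Dbar Bbar U F₁ F₂)
    (hl : 0 < l) (hq : 0 ≤ q) (hs : 0 ≤ s)
    (hconc : ∀ x y : ℝ, x ≤ y → ∀ᵐ ω ∂μ, ω ∈ F₂ →
      (μ⟦U ⁻¹' Set.Icc x y | m⟧) ω ≤ q + s * (y - x))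
    {e₁ e₂ e₃ e₄ : ℝ} (he₁ : 0 ≤ e₁) (he₂ : 0 ≤ e₂) (he₃ : 0 ≤ e₃) (he₄ : 0 ≤ e₄)
    (h₁ : ∫⁻ ω in F₁ᶜ, ENNReal.ofReal |Wstar ω - W ω| ∂μ ≤ ENNReal.ofReal e₁)
    (h₂ : ∫⁻ ω in F₂ᶜ, ENNReal.ofReal |Wstar ω - W ω| ∂μ ≤ ENNReal.ofReal e₂)
    (h₃ : ∫⁻ ω, ENNReal.ofReal (|(Wstar ω - W ω) * W ω| + Dbar ω) ∂μ ≤ ENNReal.ofReal e₃)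
    (h₄ : ∫⁻ ω in F₂, ENNReal.ofReal (Dbar ω * (Bbar ω + Dbar ω)) ∂μ ≤ ENNReal.ofReal e₄) :
    kolmogorovToNormal μ W ≤
      l + (6 * (e₁ + e₃) + 2 * e₃ + 1 / l * (e₁ + e₂ + ((q + s * l) * e₃ + 2 * s * e₄))) := by
  have hDW : ∫⁻ ω, ENNReal.ofReal |(Wstar ω - W ω) * W ω| ∂μ ≤ ENNReal.ofReal e₃ :=
    (lintegral_mono_ae (h.Dbar_nonneg.mono fun ω hω =>
      ENNReal.ofReal_le_ofReal (le_add_of_nonneg_right hω))).trans h₃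
  have hDbar : ∫⁻ ω, ENNReal.ofReal (Dbar ω) ∂μ ≤ ENNReal.ofReal e₃ :=
    (lintegral_mono fun ω =>
      ENNReal.ofReal_le_ofReal (le_add_of_nonneg_left (abs_nonneg _))).trans h₃
  have hD := h.lintegral_abs_sub_le.trans (add_le_add h₁ hDbar)
  have hconc' (z : ℝ) := (h.setLIntegral_Dbar_mul_indicator_le (z := z) hl.le hq hs hconc).trans
    (add_le_add (mul_le_mul_right hDbar _) (mul_le_mul_right h₄ _))
  have hramp (z : ℝ) := (h.lintegral_abs_ramp_sub_le (z := z) hl).trans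
    (mul_le_mul_right (add_le_add (add_le_add h₁ h₂) (hconc' z)) _)
  refine kolmogorovToNormal_le_of_ramp h.measurable_W hl fun z => ?_
  refine (ENNReal.ofReal_le_ofReal_iff (by positivity)).1 ?_
  calc ENNReal.ofReal |∫ ω, ramp z l (W ω) ∂μ - ∫ x, ramp z l x ∂(gaussianReal 0 1)|
      ≤ _ := h.isZeroBias.ofReal_abs_integral_sub_gaussian_le h.measurable_W
          h.measurable_Wstar h.integrable_W h.variance_W (continuous_ramp z l)
          (ramp_mem_Icc z l)
    _ ≤ _ := add_le_add (add_le_add (mul_le_mul_right hD _) (mul_le_mul_right hDW _)) (hramp z)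
    _ = _ := by
      rw [← ENNReal.ofReal_ofNat 6, ← ENNReal.ofReal_ofNat 2]
      repeat first
        | rw [← ENNReal.ofReal_add (by positivity) (by positivity)]
        | rw [← ENNReal.ofReal_mul (by positivity)]

theorem kolmogorovToNormal_le_of_rate
    (h : IsZeroBiasEmbedding m mΩ μ W Wstar Dbar Bbar U F₁ F₂)
    {M K ρ ρ₀ C₁ C₂ C₃ C₄ : ℝ} (hM : 0 ≤ M) (hs : 0 ≤ s) (hK : 0 < K) (hρ₀ : 0 < ρ₀) (hρ : ρ₀ ≤ ρ)
    (hC₁ : 0 ≤ C₁) (hC₂ : 0 ≤ C₂) (hC₃ : 0 ≤ C₃) (hC₄ : 0 ≤ C₄)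
    (hconc : ∀ x y : ℝ, x ≤ y → ∀ᵐ ω ∂μ, ω ∈ F₂ →
      (μ⟦U ⁻¹' Set.Icc x y | m⟧) ω ≤ 2 * M + s * (y - x))
    (h₁ : ∫⁻ ω in F₁ᶜ, ENNReal.ofReal |Wstar ω - W ω| ∂μ ≤ ENNReal.ofReal (C₁ / ρ ^ 2))
    (h₂ : ∫⁻ ω in F₂ᶜ, ENNReal.ofReal |Wstar ω - W ω| ∂μ ≤ ENNReal.ofReal (C₂ / ρ ^ 2))
    (h₃ : ∫⁻ ω, ENNReal.ofReal (|(Wstar ω - W ω) * W ω| + Dbar ω) ∂μ ≤ ENNReal.ofReal (C₃ / ρ))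
    (h₄ : ∫⁻ ω in F₂, ENNReal.ofReal (Dbar ω * (Bbar ω + Dbar ω)) ∂μ ≤
      ENNReal.ofReal (C₄ / ρ ^ 2)) :
    kolmogorovToNormal μ W ≤
      (K + 6 * C₁ / ρ₀ + 8 * C₃ + (C₁ + C₂ + s * K * C₃ + 2 * s * C₄) / K) / ρ +
        2 * C₃ / K * M := by
  have hρ_pos : 0 < ρ := hρ₀.trans_le hρ
  calc kolmogorovToNormal μ W
      ≤ K / ρ + (6 * (C₁ / ρ ^ 2 + C₃ / ρ) + 2 * (C₃ / ρ) + 1 / (K / ρ) * (C₁ / ρ ^ 2 +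
          C₂ / ρ ^ 2 + ((2 * M + s * (K / ρ)) * (C₃ / ρ) + 2 * s * (C₄ / ρ ^ 2)))) :=
        h.kolmogorovToNormal_le (by positivity) (by positivity) hs hconc (by positivity)
          (by positivity) (by positivity) (by positivity) h₁ h₂ h₃ h₄
    _ = (K + 6 * C₁ / ρ + 8 * C₃ + (C₁ + C₂ + s * K * C₃ + 2 * s * C₄) / K) / ρ +
          2 * C₃ / K * M := by
        field_simp
        ring
    _ ≤ _ := by gcongr

end IsZeroBiasEmbedding

end Embedding

section Standardized

variable {Θ Ω : Type*} [MeasurableSpace Θ] {m mΩ : MeasurableSpace Ω} {P : Kernel Θ Ω}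
  {Y : Θ → Ω → ℝ} {θ : Θ}

lemma sdAt_pos (h : 0 < varAt P Y θ) : 0 < sdAt P Y θ := Real.sqrt_pos.2 h

lemma standardized_eq (h : 0 < varAt P Y θ) :
    standardized P Y θ = fun ω => (Y θ ω - meanAt P Y θ) / sdAt P Y θ :=
  funext fun _ => if_pos (sdAt_pos h)

lemma measurable_standardized (h : 0 < varAt P Y θ) (hY : Measurable (Y θ)) :
    Measurable (standardized P Y θ) := by
  rw [standardized_eq h]
  fun_prop

variable [IsMarkovKernel P]

lemma integrable_standardized (h : 0 < varAt P Y θ) (hY : Integrable (Y θ) (P θ)) :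
    Integrable (standardized P Y θ) (P θ) := by
  rw [standardized_eq h]
  exact (hY.sub (integrable_const _)).div_const _

lemma variance_standardized (h : 0 < varAt P Y θ) (hY : AEStronglyMeasurable (Y θ) (P θ)) :
    variance (standardized P Y θ) (P θ) = 1 := by
  simp only [standardized_eq h, div_eq_inv_mul]
  rw [variance_const_mul, variance_sub_const hY, inv_pow, sdAt, Real.sq_sqrt h.le]
  exact inv_mul_cancel₀ h.ne'

lemma measureReal_preimage_Icc_le_standardized (h : 0 < varAt P Y θ) (hY : Measurable (Y θ))
    {a b : ℝ} (hab : a ≤ b) :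
    (P θ).real (Y θ ⁻¹' Set.Icc a b) ≤
      2 * kolmogorovToNormal (P θ) (standardized P Y θ) + (b - a) / sdAt P Y θ := by
  have hσ := sdAt_pos h
  have hpre : Y θ ⁻¹' Set.Icc a b = standardized P Y θ ⁻¹'
      Set.Icc ((a - meanAt P Y θ) / sdAt P Y θ) ((b - meanAt P Y θ) / sdAt P Y θ) := by
    ext ω
    simp only [Set.mem_preimage, Set.mem_Icc, standardized_eq h, div_le_div_iff_of_pos_right hσ,
      sub_le_sub_iff_right]
  have hwidth : (b - a) / sdAt P Y θ =
      (b - meanAt P Y θ) / sdAt P Y θ - (a - meanAt P Y θ) / sdAt P Y θ := by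
    rw [← sub_div, sub_sub_sub_cancel_right]
  rw [hpre, hwidth]
  exact measureReal_preimage_Icc_le_kolmogorovToNormal (μ := P θ)
    (measurable_standardized h hY) (div_le_div_of_nonneg_right (sub_le_sub_right hab _) hσ.le)

lemma isZeroBiasEmbedding_standardized {Wstar Dbar Bbar V : Ω → ℝ} {F₁ F₂ : Set Ω}
    (hm : m ≤ mΩ) (hvar : 0 < varAt P Y θ) (hY : Measurable (Y θ)) (hYi : Integrable (Y θ) (P θ))
    (hWstar : Measurable Wstar) (hV : Measurable V)
    (hzb : IsZeroBias (P θ) (standardized P Y θ) Wstar)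
    (hDbar : Measurable[m] Dbar) (hDbar_nonneg : ∀ᵐ ω ∂(P θ), 0 ≤ Dbar ω)
    (hBbar : Measurable[m] Bbar) (hBbar_nonneg : ∀ᵐ ω ∂(P θ), 0 ≤ Bbar ω)
    (hF₂ : MeasurableSet[m] F₂)
    (hD_le : ∀ᵐ ω ∂(P θ), ω ∈ F₁ → |Wstar ω - standardized P Y θ ω| ≤ Dbar ω)
    (hB_le : ∀ᵐ ω ∂(P θ), ω ∈ F₁ → (sdAt P Y θ)⁻¹ * |Y θ ω - V ω| ≤ Bbar ω) :
    IsZeroBiasEmbedding m mΩ (P θ) (standardized P Y θ) Wstar Dbar Bbar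
      (fun ω => (V ω - meanAt P Y θ) / sdAt P Y θ) F₁ F₂ where
  le := hm
  measurable_W := measurable_standardized hvar hY
  measurable_Wstar := hWstar
  measurable_U := (hV.sub_const _).div_const _
  integrable_W := integrable_standardized hvar hYi
  variance_W := variance_standardized hvar hY.aestronglyMeasurable
  isZeroBias := hzb
  measurable_Dbar := hDbar
  Dbar_nonneg := hDbar_nonneg
  measurable_Bbar := hBbar
  Bbar_nonneg := hBbar_nonneg
  measurableSet_F₂ := hF₂
  abs_Wstar_sub_W_le := hD_le
  abs_W_sub_U_le := by
    filter_upwards [hB_le] with ω hω hF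
    rw [standardized_eq hvar, ← sub_div, sub_sub_sub_cancel_right, abs_div,
      abs_of_pos (sdAt_pos hvar), div_eq_inv_mul]
    exact hω hF

end Standardized

section KolmogorovError

variable {Θ Ω : Type*} [MeasurableSpace Θ] {m mΩ : MeasurableSpace Ω} {P : Kernel Θ Ω}
  {Y : Θ → Ω → ℝ} {r : Θ → ℝ} {rbar : ℝ} {θ θ' : Θ}

open Classical in
/-- The Kolmogorov distance to be bounded, replaced by the trivial bound `1` off
`goodSet r rbar`. There the variance may vanish, so that the distance gives no control of the
concentration of `Y`, whereas the embedded parameter `Ψ` may take values there. -/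
noncomputable def kolmogorovError (P : Kernel Θ Ω) (Y : Θ → Ω → ℝ) (r : Θ → ℝ) (rbar : ℝ) (θ : Θ) :
    ℝ :=
  if θ ∈ goodSet r rbar then kolmogorovToNormal (P θ) (standardized P Y θ) else 1

lemma kolmogorovError_of_mem (h : θ ∈ goodSet r rbar) :
    kolmogorovError P Y r rbar θ = kolmogorovToNormal (P θ) (standardized P Y θ) := if_pos h

lemma kolmogorovError_of_notMem (h : θ ∉ goodSet r rbar) : kolmogorovError P Y r rbar θ = 1 :=
  if_neg h

lemma kolmogorovError_le_div_of_notMem {A : ℝ} (h : θ ∉ goodSet r rbar) (hr : 0 < r θ)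
    (hA : rbar ≤ A) : kolmogorovError P Y r rbar θ ≤ A / r θ := by
  rw [kolmogorovError_of_notMem h, one_le_div hr]
  exact (not_lt.1 h).trans hA

lemma kolmogorovError_nonneg : 0 ≤ kolmogorovError P Y r rbar θ := by
  rw [kolmogorovError]
  split_ifs
  exacts [kolmogorovToNormal_nonneg _ _, zero_le_one]

variable [IsMarkovKernel P]

lemma kolmogorovError_le_one : kolmogorovError P Y r rbar θ ≤ 1 := by
  rw [kolmogorovError]
  split_ifs
  exacts [kolmogorovToNormal_le_one _, le_rfl]

lemma kolmogorovToNormal_le_kolmogorovError :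
    kolmogorovToNormal (P θ) (standardized P Y θ) ≤ kolmogorovError P Y r rbar θ := by
  rw [kolmogorovError]
  split_ifs
  exacts [le_rfl, kolmogorovToNormal_le_one _]

lemma measureReal_preimage_Icc_le_kolmogorovError {v a b : ℝ} (hab : a ≤ b)
    (hY : ∀ θ ∈ goodSet r rbar, Measurable (Y θ)) (hvar : ∀ θ ∈ goodSet r rbar, 0 < varAt P Y θ)
    (hθ : θ ∈ goodSet r rbar)
    (hσ : θ' ∈ goodSet r rbar → varAt P Y θ / varAt P Y θ' ≤ v) :
    (P θ').real (Y θ' ⁻¹' Set.Icc a b) ≤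
      2 * kolmogorovError P Y r rbar θ' + √v * ((b - a) / sdAt P Y θ) := by
  have hσθ : 0 < sdAt P Y θ := sdAt_pos (hvar θ hθ)
  have : 0 ≤ (b - a) / sdAt P Y θ := div_nonneg (sub_nonneg.2 hab) hσθ.le
  by_cases hθ' : θ' ∈ goodSet r rbar
  · have : 0 < sdAt P Y θ' := sdAt_pos (hvar θ' hθ')
    have hratio : sdAt P Y θ / sdAt P Y θ' ≤ √v := by
      rw [sdAt, sdAt, ← Real.sqrt_div' _ (hvar θ' hθ').le]
      exact Real.sqrt_le_sqrt (hσ hθ')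
    calc (P θ').real (Y θ' ⁻¹' Set.Icc a b)
        ≤ 2 * kolmogorovToNormal (P θ') (standardized P Y θ') + (b - a) / sdAt P Y θ' :=
          measureReal_preimage_Icc_le_standardized (hvar θ' hθ') (hY θ' hθ') hab
      _ = 2 * kolmogorovError P Y r rbar θ' +
            sdAt P Y θ / sdAt P Y θ' * ((b - a) / sdAt P Y θ) := by
          rw [kolmogorovError_of_mem hθ', div_mul_div_cancel₀' hσθ.ne']
      _ ≤ _ := by gcongr
  · rw [kolmogorovError_of_notMem hθ']
    have hprob : (P θ').real (Y θ' ⁻¹' Set.Icc a b) ≤ 1 := measureReal_le_one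
    have : 0 ≤ √v * ((b - a) / sdAt P Y θ) := by positivity
    linarith

lemma condExp_preimage_Icc_le_of_embedding {V : Ω → ℝ} {Ψ : Ω → Θ}
    {F : Set Ω} {t v M x y : ℝ}
    (hY : ∀ θ ∈ goodSet r rbar, Measurable (Y θ)) (hvar : ∀ θ ∈ goodSet r rbar, 0 < varAt P Y θ)
    (hr : ∀ θ, 0 < r θ) (hθ : θ ∈ goodSet r rbar)
    (hlaw : ∀ A : Set ℝ, MeasurableSet A → ∀ᵐ ω ∂(P θ), ω ∈ F →
      ((P θ)⟦V ⁻¹' A | m⟧) ω = (P (Ψ ω)).real (Y (Ψ ω) ⁻¹' A))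
    (hσ_ratio : ∀ᵐ ω ∂(P θ), ω ∈ F ∩ {ω | Ψ ω ∈ goodSet r rbar} →
      varAt P Y θ / varAt P Y (Ψ ω) ≤ v)
    (hr_ratio : ∀ᵐ ω ∂(P θ), ω ∈ F → r θ / r (Ψ ω) ≤ t)
    (hM : ∀ θ', r θ ≤ t * r θ' → kolmogorovError P Y r rbar θ' ≤ M) (hxy : x ≤ y) :
    ∀ᵐ ω ∂(P θ), ω ∈ F →
      ((P θ)⟦(fun ω => (V ω - meanAt P Y θ) / sdAt P Y θ) ⁻¹' Set.Icc x y | m⟧) ω ≤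
        2 * M + √v * (y - x) := by
  have hσ : 0 < sdAt P Y θ := sdAt_pos (hvar θ hθ)
  have hpre : (fun ω => (V ω - meanAt P Y θ) / sdAt P Y θ) ⁻¹' Set.Icc x y = V ⁻¹'
      Set.Icc (x * sdAt P Y θ + meanAt P Y θ) (y * sdAt P Y θ + meanAt P Y θ) := by
    ext ω
    simp only [Set.mem_preimage, Set.mem_Icc, le_div_iff₀ hσ, div_le_iff₀ hσ, le_sub_iff_add_le,
      sub_le_iff_le_add]
  rw [hpre]
  filter_upwards [hlaw _ measurableSet_Icc, hσ_ratio, hr_ratio] with ω hlawω hσω hrω hF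
  have hδ := hM (Ψ ω) ((div_le_iff₀ (hr _)).1 (hrω hF))
  calc _ = _ := hlawω hF
    _ ≤ 2 * kolmogorovError P Y r rbar (Ψ ω) + √v * (((y * sdAt P Y θ + meanAt P Y θ) -
          (x * sdAt P Y θ + meanAt P Y θ)) / sdAt P Y θ) :=
        measureReal_preimage_Icc_le_kolmogorovError (by gcongr) hY hvar hθ fun hΨ => hσω ⟨hF, hΨ⟩
    _ = 2 * kolmogorovError P Y r rbar (Ψ ω) + √v * (y - x) := by
        rw [add_sub_add_right_eq_sub, ← sub_mul, mul_div_cancel_right₀ _ hσ.ne']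
    _ ≤ 2 * M + √v * (y - x) := by gcongr

end KolmogorovError

section UniformBounds

variable {ι : Type*} {S : Set ι}

lemma exists_pos_forall_le_ofReal_div {a : ι → ℝ} {J : ι → ℝ≥0∞} (ha : ∀ i, 0 < a i)
    (h : (⨆ i ∈ S, ENNReal.ofReal (a i) * J i) < ∞) :
    ∃ C : ℝ, 0 < C ∧ ∀ i ∈ S, J i ≤ ENNReal.ofReal (C / a i) := by
  refine ⟨(⨆ i ∈ S, ENNReal.ofReal (a i) * J i).toReal + 1, by positivity, fun i hi => ?_⟩
  rw [ENNReal.ofReal_div_of_pos (ha i), ENNReal.le_div_iff_mul_le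
    (.inl (ENNReal.ofReal_pos.2 (ha i)).ne') (.inl ENNReal.ofReal_ne_top), mul_comm]
  calc ENNReal.ofReal (a i) * J i
      ≤ ⨆ i ∈ S, ENNReal.ofReal (a i) * J i := le_iSup₂_of_le i hi le_rfl
    _ ≤ ENNReal.ofReal ((⨆ i ∈ S, ENNReal.ofReal (a i) * J i).toReal + 1) :=
        (ENNReal.le_ofReal_iff_toReal_le h.ne (by positivity)).2
          (le_add_of_nonneg_right zero_le_one)

lemma exists_forall_ae_le_of_iSup_essSup_lt_top {Ω : Type*} [MeasurableSpace Ω]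
    {μ : ι → Measure Ω} {F : ι → Set Ω} {u : ι → Ω → ℝ}
    (h : (⨆ i ∈ S, essSup (fun ω => ENNReal.ofReal (u i ω)) ((μ i).restrict (F i))) < ∞) :
    ∃ C : ℝ, ∀ i ∈ S, ∀ᵐ ω ∂(μ i), ω ∈ F i → u i ω ≤ C := by
  refine ⟨(⨆ i ∈ S, essSup (fun ω => ENNReal.ofReal (u i ω)) ((μ i).restrict (F i))).toReal,
    fun i hi => ae_imp_of_ae_restrict ?_⟩
  filter_upwards [ENNReal.ae_le_essSup (μ := (μ i).restrict (F i))
    fun ω => ENNReal.ofReal (u i ω)] with ω hω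
  exact (ENNReal.ofReal_le_iff_le_toReal h.ne).1 (hω.trans (le_iSup₂_of_le i hi le_rfl))

end UniformBounds

lemma le_div_of_contractive_recursion {Θ : Type*} {r η : Θ → ℝ} {A c : ℝ} (hr : ∀ θ, 0 < r θ)
    (hη₀ : ∀ θ, 0 ≤ η θ) (hη₁ : ∀ θ, η θ ≤ 1) (hA : 0 ≤ A) (hc : 1 ≤ c)
    (step : ∀ θ M, 0 ≤ M → (∀ θ', r θ ≤ c * r θ' → η θ' ≤ M) →
      η θ ≤ A / r θ + 1 / (2 * c) * M) (θ : Θ) :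
    η θ ≤ 2 * A / r θ := by
  -- Truncating the rate at `R` makes the weighted supremum finite, so that it can be absorbed.
  let R := r θ
  let S := ⨆ θ', min (r θ') R * η θ'
  have hbdd : BddAbove (Set.range fun θ' => min (r θ') R * η θ') :=
    ⟨R, Set.forall_mem_range.2 fun θ' =>
      (mul_le_of_le_one_right (lt_min (hr θ') (hr θ)).le (hη₁ θ')).trans (min_le_right _ _)⟩
  have hle_S (θ') : min (r θ') R * η θ' ≤ S := le_ciSup hbdd θ'
  have hS₀ : 0 ≤ S := Real.iSup_nonneg fun θ' => mul_nonneg (lt_min (hr θ') (hr θ)).le (hη₀ θ')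
  have hS_self : S ≤ A + S / 2 := by
    have : Nonempty Θ := ⟨θ⟩
    refine ciSup_le fun θ₁ => ?_
    have hmin (θ') : 0 < min (r θ') R := lt_min (hr θ') (hr θ)
    have hη_le : η θ₁ ≤ A / r θ₁ + 1 / (2 * c) * (c * S / min (r θ₁) R) := by
      refine step θ₁ _ (div_nonneg (by positivity) (hmin θ₁).le) fun θ₂ hθ₂ => ?_
      have hmin_le : min (r θ₁) R ≤ c * min (r θ₂) R := by
        rw [mul_min_of_nonneg _ _ (by positivity)]
        exact min_le_min hθ₂ (le_mul_of_one_le_left (hr θ).le hc)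
      rw [le_div_iff₀ (hmin θ₁)]
      calc η θ₂ * min (r θ₁) R ≤ η θ₂ * (c * min (r θ₂) R) := by gcongr; exact hη₀ θ₂
        _ = c * (min (r θ₂) R * η θ₂) := by ring
        _ ≤ c * S := by gcongr; exact hle_S θ₂
    calc min (r θ₁) R * η θ₁
        ≤ min (r θ₁) R * (A / r θ₁ + 1 / (2 * c) * (c * S / min (r θ₁) R)) := by
          gcongr
          exact (hmin θ₁).le
      _ = min (r θ₁) R / r θ₁ * A + S / 2 := by
          have := (hmin θ₁).ne'
          have := (hr θ₁).ne'
          field_simp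
      _ ≤ A + S / 2 := by
          gcongr
          exact mul_le_of_le_one_left hA ((div_le_one (hr θ₁)).2 (min_le_left _ _))
  have hθS : r θ * η θ ≤ S := by simpa only [R, min_self] using hle_S θ
  rw [le_div_iff₀ (hr θ), mul_comm]
  linarith

theorem theorem2_general {Θ Ω : Type*} [MeasurableSpace Θ] [mΩ : MeasurableSpace Ω]
    (P : Kernel Θ Ω) [IsMarkovKernel P] (Y Wstar Dbar V Bbar : Θ → Ω → ℝ) (Ψ : Θ → Ω → Θ)
    (r : Θ → ℝ) (hr_pos : ∀ θ, 0 < r θ) (rbar : ℝ) (hrbar : 0 < rbar)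
    (hY : ∀ θ ∈ goodSet r rbar, Measurable (Y θ))
    (hWstar : ∀ θ ∈ goodSet r rbar, Measurable (Wstar θ))
    (hV : ∀ θ ∈ goodSet r rbar, Measurable (V θ))
    (hY2 : ∀ θ ∈ goodSet r rbar, MemLp (Y θ) 2 (P θ))
    (hvar : ∀ θ ∈ goodSet r rbar, 0 < varAt P Y θ)
    (hzb : ∀ θ ∈ goodSet r rbar, IsZeroBias (P θ) (standardized P Y θ) (Wstar θ))
    (ℱ : Θ → MeasurableSpace Ω) (hℱ : ∀ θ ∈ goodSet r rbar, ℱ θ ≤ mΩ)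
    (hDbar_meas : ∀ θ ∈ goodSet r rbar, Measurable[ℱ θ] (Dbar θ))
    (hDbar_nonneg : ∀ θ ∈ goodSet r rbar, ∀ᵐ ω ∂(P θ), 0 ≤ Dbar θ ω)
    (F₁ : Θ → Set Ω)
    (hD_le : ∀ θ ∈ goodSet r rbar, ∀ᵐ ω ∂(P θ), ω ∈ F₁ θ →
      |Wstar θ ω - standardized P Y θ ω| ≤ Dbar θ ω)
    (hD_F₁ : (⨆ θ ∈ goodSet r rbar, ENNReal.ofReal (r θ ^ 2) *
      ∫⁻ ω in (F₁ θ)ᶜ, ENNReal.ofReal |Wstar θ ω - standardized P Y θ ω| ∂(P θ)) < ∞)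
    (hDW : (⨆ θ ∈ goodSet r rbar, ENNReal.ofReal (r θ) *
      ∫⁻ ω, ENNReal.ofReal
        (|(Wstar θ ω - standardized P Y θ ω) * standardized P Y θ ω| + Dbar θ ω) ∂(P θ)) < ∞)
    (F₂ : Θ → Set Ω) (hF₂ : ∀ θ ∈ goodSet r rbar, MeasurableSet[ℱ θ] (F₂ θ))
    (hlaw : ∀ θ ∈ goodSet r rbar, ∀ A : Set ℝ, MeasurableSet A →
      ∀ᵐ ω ∂(P θ), ω ∈ F₂ θ →
        ((P θ)⟦V θ ⁻¹' A | ℱ θ⟧) ω = (P (Ψ θ ω)).real (Y (Ψ θ ω) ⁻¹' A))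
    (hD_F₂ : (⨆ θ ∈ goodSet r rbar, ENNReal.ofReal (r θ ^ 2) *
      ∫⁻ ω in (F₂ θ)ᶜ, ENNReal.ofReal |Wstar θ ω - standardized P Y θ ω| ∂(P θ)) < ∞)
    (hBbar_meas : ∀ θ ∈ goodSet r rbar, Measurable[ℱ θ] (Bbar θ))
    (hBbar_nonneg : ∀ θ ∈ goodSet r rbar, ∀ᵐ ω ∂(P θ), 0 ≤ Bbar θ ω)
    (hB_le : ∀ θ ∈ goodSet r rbar, ∀ᵐ ω ∂(P θ), ω ∈ F₁ θ →
      (sdAt P Y θ)⁻¹ * |Y θ ω - V θ ω| ≤ Bbar θ ω)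
    (hDB : (⨆ θ ∈ goodSet r rbar, ENNReal.ofReal (r θ ^ 2) *
      ∫⁻ ω in F₂ θ, ENNReal.ofReal (Dbar θ ω * (Bbar θ ω + Dbar θ ω)) ∂(P θ)) < ∞)
    (hσ_ratio : (⨆ θ ∈ goodSet r rbar,
      essSup (fun ω => ENNReal.ofReal (varAt P Y θ / varAt P Y (Ψ θ ω)))
        ((P θ).restrict (F₂ θ ∩ {ω | Ψ θ ω ∈ goodSet r rbar}))) < ∞)
    (hr_ratio : (⨆ θ ∈ goodSet r rbar,
      essSup (fun ω => ENNReal.ofReal (r θ / r (Ψ θ ω))) ((P θ).restrict (F₂ θ))) < ∞) :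
    ∃ C : ℝ, ∀ θ, kolmogorovToNormal (P θ) (standardized P Y θ) ≤ C / r θ := by
  have hr_sq (θ) : 0 < r θ ^ 2 := pow_pos (hr_pos θ) 2
  obtain ⟨C₁, hC₁, h₁⟩ := exists_pos_forall_le_ofReal_div hr_sq hD_F₁
  obtain ⟨C₂, hC₂, h₂⟩ := exists_pos_forall_le_ofReal_div hr_sq hD_F₂
  obtain ⟨C₃, hC₃, h₃⟩ := exists_pos_forall_le_ofReal_div hr_pos hDW
  obtain ⟨C₄, hC₄, h₄⟩ := exists_pos_forall_le_ofReal_div hr_sq hDB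
  obtain ⟨v, hv⟩ := exists_forall_ae_le_of_iSup_essSup_lt_top hσ_ratio
  obtain ⟨t, ht⟩ := exists_forall_ae_le_of_iSup_essSup_lt_top hr_ratio
  let c := max t 1
  have hc : 1 ≤ c := le_max_right _ _
  -- The smoothing scale is chosen to make the factor in front of `M` equal to `1 / (2 * c)`.
  let K := 4 * c * C₃
  let A₀ := K + 6 * C₁ / rbar + 8 * C₃ + (C₁ + C₂ + √v * K * C₃ + 2 * √v * C₄) / K
  let A := max A₀ rbar
  refine ⟨2 * A, fun θ₀ => kolmogorovToNormal_le_kolmogorovError.trans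
    (le_div_of_contractive_recursion (η := kolmogorovError P Y r rbar) (A := A) hr_pos
      (fun _ => kolmogorovError_nonneg) (fun _ => kolmogorovError_le_one)
      (hrbar.le.trans (le_max_right _ _)) hc (fun θ M hM hηM => ?_) θ₀)⟩
  by_cases hθ : θ ∈ goodSet r rbar
  · have hembed := isZeroBiasEmbedding_standardized (hℱ θ hθ) (hvar θ hθ) (hY θ hθ)
      ((hY2 θ hθ).integrable one_le_two) (hWstar θ hθ) (hV θ hθ) (hzb θ hθ) (hDbar_meas θ hθ)
      (hDbar_nonneg θ hθ) (hBbar_meas θ hθ) (hBbar_nonneg θ hθ) (hF₂ θ hθ) (hD_le θ hθ)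
      (hB_le θ hθ)
    have hbound := hembed.kolmogorovToNormal_le_of_rate (K := K) hM (Real.sqrt_nonneg v)
      (by positivity) hrbar (le_of_lt hθ) hC₁.le hC₂.le hC₃.le hC₄.le
      (fun x y hxy => condExp_preimage_Icc_le_of_embedding hY hvar hr_pos hθ (hlaw θ hθ)
        (hv θ hθ) ((ht θ hθ).mono fun ω hω hF => (hω hF).trans (le_max_left t 1)) hηM hxy)
      (h₁ θ hθ) (h₂ θ hθ) (h₃ θ hθ) (h₄ θ hθ)
    have hfactor : 2 * C₃ / K = 1 / (2 * c) := by simp only [K]; field_simp; norm_num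
    rw [kolmogorovError_of_mem hθ, ← hfactor]
    refine hbound.trans ?_
    gcongr
    exacts [(hr_pos θ).le, le_max_left _ _]
  · exact (kolmogorovError_le_div_of_notMem hθ (hr_pos θ) (le_max_right _ _)).trans
      (le_add_of_nonneg_right (by positivity))

theorem theorem2
    -- parameter space, sample space, transition kernel
    {Θ Ω : Type*} [MeasurableSpace Θ] [mΩ : MeasurableSpace Ω]
    (P : Kernel Θ Ω) [IsMarkovKernel P]
    -- random variables are jointly measurable functions of `(θ, ω)`
    (Y Wstar Dbar V Bbar : Θ → Ω → ℝ) (Ψ : Θ → Ω → Θ)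
    (hY : Measurable (fun p : Θ × Ω => Y p.1 p.2))
    (hWstar : Measurable (fun p : Θ × Ω => Wstar p.1 p.2))
    (hDbar : Measurable (fun p : Θ × Ω => Dbar p.1 p.2))
    (hV : Measurable (fun p : Θ × Ω => V p.1 p.2))
    (hBbar : Measurable (fun p : Θ × Ω => Bbar p.1 p.2))
    (hΨ : Measurable (fun p : Θ × Ω => Ψ p.1 p.2))
    (hY2 : ∀ θ, MemLp (Y θ) 2 (P θ))
    -- (Z1): rate function and threshold
    (r : Θ → ℝ) (hr : Measurable r) (hr_pos : ∀ θ, 0 < r θ)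
    (rbar : ℝ) (hrbar : 0 < rbar)
    (hvar : ∀ θ ∈ goodSet r rbar, 0 < varAt P Y θ)
    -- (Z2): zero bias coupling
    (hzb : ∀ θ ∈ goodSet r rbar, IsZeroBias (P θ) (standardized P Y θ) (Wstar θ))
    -- (Z3): majorant of `D = Wstar - W` on `F₁`
    (ℱ : Θ → MeasurableSpace Ω) (hℱ : ∀ θ ∈ goodSet r rbar, ℱ θ ≤ mΩ)
    (hDbar_meas : ∀ θ ∈ goodSet r rbar, Measurable[ℱ θ] (Dbar θ))
    (hDbar_nonneg : ∀ θ ∈ goodSet r rbar, ∀ᵐ ω ∂(P θ), 0 ≤ Dbar θ ω)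
    (F₁ : Θ → Set Ω) (hF₁ : ∀ θ ∈ goodSet r rbar, MeasurableSet (F₁ θ))
    (hD_le : ∀ θ ∈ goodSet r rbar, ∀ᵐ ω ∂(P θ), ω ∈ F₁ θ →
      |Wstar θ ω - standardized P Y θ ω| ≤ Dbar θ ω)
    (hD_F₁ : (⨆ θ ∈ goodSet r rbar, ENNReal.ofReal (r θ ^ 2) *
      ∫⁻ ω in (F₁ θ)ᶜ, ENNReal.ofReal |Wstar θ ω - standardized P Y θ ω| ∂(P θ)) < ∞)
    (hDW : (⨆ θ ∈ goodSet r rbar, ENNReal.ofReal (r θ) *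
      ∫⁻ ω, ENNReal.ofReal
        (|(Wstar θ ω - standardized P Y θ ω) * standardized P Y θ ω| + Dbar θ ω) ∂(P θ)) < ∞)
    -- (Z4): embedded variable
    (hΨ_meas : ∀ θ ∈ goodSet r rbar, Measurable[ℱ θ] (Ψ θ))
    (F₂ : Θ → Set Ω) (hF₂ : ∀ θ ∈ goodSet r rbar, MeasurableSet[ℱ θ] (F₂ θ))
    (hlaw : ∀ θ ∈ goodSet r rbar, ∀ A : Set ℝ, MeasurableSet A →
      ∀ᵐ ω ∂(P θ), ω ∈ F₂ θ →
        ((P θ)⟦V θ ⁻¹' A | ℱ θ⟧) ω = (P (Ψ θ ω)).real (Y (Ψ θ ω) ⁻¹' A))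
    (hD_F₂ : (⨆ θ ∈ goodSet r rbar, ENNReal.ofReal (r θ ^ 2) *
      ∫⁻ ω in (F₂ θ)ᶜ, ENNReal.ofReal |Wstar θ ω - standardized P Y θ ω| ∂(P θ)) < ∞)
    -- (Z5): bound on `|Y - V|`
    (hBbar_meas : ∀ θ ∈ goodSet r rbar, Measurable[ℱ θ] (Bbar θ))
    (hBbar_nonneg : ∀ θ ∈ goodSet r rbar, ∀ᵐ ω ∂(P θ), 0 ≤ Bbar θ ω)
    (hB_le : ∀ θ ∈ goodSet r rbar, ∀ᵐ ω ∂(P θ), ω ∈ F₁ θ →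
      (sdAt P Y θ)⁻¹ * |Y θ ω - V θ ω| ≤ Bbar θ ω)
    (hDB : (⨆ θ ∈ goodSet r rbar, ENNReal.ofReal (r θ ^ 2) *
      ∫⁻ ω in F₂ θ, ENNReal.ofReal (Dbar θ ω * (Bbar θ ω + Dbar θ ω)) ∂(P θ)) < ∞)
    -- (G7): comparison of variances and rates
    (hσ_ratio : (⨆ θ ∈ goodSet r rbar,
      essSup (fun ω => ENNReal.ofReal (varAt P Y θ / varAt P Y (Ψ θ ω)))
        ((P θ).restrict (F₂ θ ∩ {ω | Ψ θ ω ∈ goodSet r rbar}))) < ∞)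
    (hr_ratio : (⨆ θ ∈ goodSet r rbar,
      essSup (fun ω => ENNReal.ofReal (r θ / r (Ψ θ ω))) ((P θ).restrict (F₂ θ))) < ∞)
    (hr_ratio' : (⨆ θ ∈ goodSet r rbar,
      essSup (fun ω => ENNReal.ofReal (r (Ψ θ ω) / r θ))
        ((P θ).restrict (F₂ θ ∩ {ω | Ψ θ ω ∈ goodSet r rbar}))) < ∞) :
    ∃ C : ℝ, ∀ θ, kolmogorovToNormal (P θ) (standardized P Y θ) ≤ C / r θ :=
  theorem2_general P Y Wstar Dbar V Bbar Ψ r hr_pos rbar hrbar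
    (fun _ _ => hY.comp measurable_prodMk_left) (fun _ _ => hWstar.comp measurable_prodMk_left)
    (fun _ _ => hV.comp measurable_prodMk_left) (fun θ _ => hY2 θ) hvar hzb ℱ hℱ hDbar_meas
    hDbar_nonneg F₁ hD_le hD_F₁ hDW F₂ hF₂ hlaw hD_F₂ hBbar_meas hBbar_nonneg hB_le hDB hσ_ratio
    hr_ratio
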